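/- For an open interval $J\subseteq\mathbb R$ and a locally integrable $f:J\to\mathbb R$ put $$\|f\|_{BLO(J)}=\sup_{I}\Big(\frac1{|I|}\int_I f\,dx-\inf_I f\Big)\in[0,\infty],$$ where $I$ ranges over the nondegenerate compact intervals contained in $J$ and $\inf_I$ is the essential infimum. Let $BLO(J)$ be the set of locally integrable $f$ on $J$ with $\|f\|_{BLO(J)}<\infty$. For $k\in\mathbb N$ let $T_kf=\max(-k,\min(k,f))$, and put $$T(J)=\{f\in BLO(J):\ \lim_{k\to\infty}\|f-T_kf\|_{BLO(J)}=0\},\qquad \overline{L^\infty(J)}^{BLO}=\{f\in BLO(J):\ \inf_{g\in L^\infty(J)}\|f-g\|_{BLO(J)}=0\}.$$ Let $A_1(J)$ be the class of locally integrable, almost everywhere positive $w$ on $J$ with $\sup_{I}\frac{\frac1{|I|}\int_I w\,dx}{\inf_I w}<\infty$, with $I$ as above. Then, both for $J=\mathbb R$ and for $J=(0,1/e)$, $$L^\infty(J)\subsetneq T(J)\subsetneq\overline{L^\infty(J)}^{BLO}.$$ Moreover, on $J=(0,1/e)$: (i) the function $f(x)=\log(-\log x)$ does not belong to $L^\infty(J)$,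 but it belongs to $T(J)$; also $e^{f/\mu}\in A_1(J)$ for every $\mu>0$; (ii) the step function $\eta=\sum_{n=0}^\infty n\,\chi_{[a_{n+1},a_n)}$ with $a_n=e^{-e^n}$ belongs to $\overline{L^\infty(J)}^{BLO}$, but not to $T(J)$; also $e^{\eta/\mu}\in A_1(J)$ for every $\mu>0$. -/

import Mathlib

open MeasureTheory Set Filter Topology
open scoped ENNReal

noncomputable section

namespace LowerOscillation

/-- The lower oscillation `f_I - inf_I f` of `f` on `I = [a, b]`, where `f_I` is the mean of `f`
over `I` and `inf_I` is the essential infimum. The essential infimum is taken in `EReal`, so that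
it is `-∞` (and the oscillation is `∞`) when `f` is not essentially bounded below on `I`. -/
def lowerOsc (f : ℝ → ℝ) (a b : ℝ) : ℝ≥0∞ :=
  (((⨍ x in Icc a b, f x : ℝ) : EReal)
    - essInf (fun x => (f x : EReal)) (volume.restrict (Icc a b))).toENNReal

/-- `‖f‖_{BLO(J)}`: the supremum of the lower oscillations of `f` over all nondegenerate compact
intervals contained in `J`. -/
def bloNorm (J : Set ℝ) (f : ℝ → ℝ) : ℝ≥0∞ :=
  ⨆ (a : ℝ) (b : ℝ) (_ : a < b) (_ : Icc a b ⊆ J), lowerOsc f a b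

/-- The class `BLO(J)` of functions of bounded lower oscillation on `J`. -/
def BLO (J : Set ℝ) : Set (ℝ → ℝ) :=
  {f | LocallyIntegrableOn f J volume ∧ bloNorm J f < ∞}

/-- The class `L^∞(J)` of essentially bounded measurable functions on `J`. -/
def Linfty (J : Set ℝ) : Set (ℝ → ℝ) :=
  {f | MemLp f ∞ (volume.restrict J)}

/-- The truncation `T_k f` of `f` at the levels `-k` and `k`. -/
def trunc (k : ℕ) (f : ℝ → ℝ) : ℝ → ℝ :=
  fun x => max (-(k : ℝ)) (min (k : ℝ) (f x))

/-- The class `T` of the functions of `BLO(J)` that are approximated by their truncations. -/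
def TruncApprox (J : Set ℝ) : Set (ℝ → ℝ) :=
  {f | f ∈ BLO J ∧ Tendsto (fun k : ℕ => bloNorm J (f - trunc k f)) atTop (𝓝 0)}

/-- The distance `inf {‖f - g‖_{BLO(J)} : g ∈ L^∞(J)}` of `f` from `L^∞(J)`. -/
def distLinfty (J : Set ℝ) (f : ℝ → ℝ) : ℝ≥0∞ :=
  ⨅ g ∈ Linfty J, bloNorm J (f - g)

/-- The closure of `L^∞(J)` in `BLO(J)`. -/
def closureLinfty (J : Set ℝ) : Set (ℝ → ℝ) :=
  {f | f ∈ BLO J ∧ distLinfty J f = 0}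

/-- The `A_1` constant of `w` on `J`: the supremum of `w_I / inf_I w` over all nondegenerate
compact intervals `I` contained in `J`. -/
def A1Const (J : Set ℝ) (w : ℝ → ℝ) : ℝ≥0∞ :=
  ⨆ (a : ℝ) (b : ℝ) (_ : a < b) (_ : Icc a b ⊆ J),
    ENNReal.ofReal (⨍ x in Icc a b, w x) /
      essInf (fun x => ENNReal.ofReal (w x)) (volume.restrict (Icc a b))

/-- The Muckenhoupt class `A_1(J)`: locally integrable, almost everywhere positive weights with
finite `A_1` constant. -/
def MuckenhouptA1 (J : Set ℝ) : Set (ℝ → ℝ) :=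
  {w | LocallyIntegrableOn w J volume ∧ (∀ᵐ x ∂(volume.restrict J), 0 < w x) ∧ A1Const J w < ∞}

/-- The interval `(0, 1/e)`. -/
def baseInterval : Set ℝ := Ioo 0 (1 / Real.exp 1)

/-- The function `x ↦ log (-log x)`. -/
def logLog (x : ℝ) : ℝ := Real.log (-Real.log x)

/-- The sequence `a_n = e^{-e^n}`. -/
def stepPoint (n : ℕ) : ℝ := Real.exp (-Real.exp (n : ℝ))

/-- The step function `∑ n χ_{[a_{n+1}, a_n)}`; at each point at most one term is nonzero. -/
def stepFun (x : ℝ) : ℝ :=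
  ∑' n : ℕ, (n : ℝ) * (Ico (stepPoint (n + 1)) (stepPoint n)).indicator (fun _ => (1 : ℝ)) x

end LowerOscillation

end

noncomputable section
namespace LowerOscillation

/-! ### Estimating oscillations and `A_1` ratios on one interval -/

/-! Everything rests on `F = logLogAbove 1`, that is `F(x) = log max(1, -log|x|)` for `x ≠ 0`. For
`F_K = logLogAbove K` and `0 < |x| ≤ r`, `F_K(x)` exceeds `F_K(r)` by at most `log(1 + log(r/|x|)/K)
≤ (2/K) √(r/|x|)`. With `r = max |a| |b|`, the mean of `√(r/|x|)` over `[a, b]` is at most 4, while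
`F_K ≥ F_K(r)` a.e. there; so `‖F_K‖ ≤ 8/K`. Since `F - T_k F = F_K` with `K = e^k`
(`sub_trunc_logLogAbove`), `F` is approximated by its truncations.

The step function `η` satisfies `F - 1 ≤ η ≤ F`. Subtracting from `η` the bounded function `(η - F)
+ T_k F` leaves `F - T_k F`, so `η` lies in the closure. But `η - T_k η` keeps a unit jump at
`a_{k+1}` for every `k`, so its norm is at least `1/2` (`half_le_bloNorm_stepFun_sub_trunc`).

The `A_1` claims use the same comparison, with `log(1 + s)/μ ≤ c_μ + s/2`. Positive results are
proved on the line and restricted to `(0, 1/e)`; negative ones are proved on `(0, 1/e)` and so hold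
on the line. -/

lemma le_essInf_coe {f : ℝ → ℝ} {a b m : ℝ}
    (hm : ∀ᵐ x ∂(volume.restrict (Icc a b)), m ≤ f x) :
    (m : EReal) ≤ essInf (fun x => (f x : EReal)) (volume.restrict (Icc a b)) :=
  le_essInf_of_ae_le _ (hm.mono fun _ hx => EReal.coe_le_coe_iff.2 hx)

lemma lowerOsc_le {f : ℝ → ℝ} {a b m M : ℝ}
    (hm : ∀ᵐ x ∂(volume.restrict (Icc a b)), m ≤ f x) (hM : ⨍ x in Icc a b, f x ≤ M) :
    lowerOsc f a b ≤ ENNReal.ofReal (M - m) := by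
  have h := EReal.sub_le_sub (EReal.coe_le_coe_iff.2 hM) (le_essInf_coe hm)
  refine (EReal.toENNReal_le_toENNReal h).trans ?_
  rw [← EReal.coe_sub, EReal.toENNReal_of_ne_top (EReal.coe_ne_top _), EReal.toReal_coe]

lemma le_lowerOsc {f : ℝ → ℝ} {a b m M : ℝ}
    (hm : ∃ᶠ x in ae (volume.restrict (Icc a b)), f x ≤ m) (hM : M ≤ ⨍ x in Icc a b, f x) :
    ENNReal.ofReal (M - m) ≤ lowerOsc f a b := by
  have h1 : essInf (fun x => (f x : EReal)) (volume.restrict (Icc a b)) ≤ (m : EReal) :=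
    liminf_le_of_frequently_le' (hm.mono fun _ hx => EReal.coe_le_coe_iff.2 hx)
  have h := EReal.sub_le_sub (EReal.coe_le_coe_iff.2 hM) h1
  refine le_trans ?_ (EReal.toENNReal_le_toENNReal h)
  rw [← EReal.coe_sub, EReal.toENNReal_of_ne_top (EReal.coe_ne_top _), EReal.toReal_coe]

lemma setAverage_Icc_eq {a b : ℝ} (hab : a < b) (f : ℝ → ℝ) :
    ⨍ x in Icc a b, f x = (∫ x in Icc a b, f x) / (b - a) := by
  rw [setAverage_eq, Real.volume_real_Icc_of_le hab.le, smul_eq_mul, inv_mul_eq_div]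

lemma setAverage_Icc_mono {f g : ℝ → ℝ} {a b : ℝ} (hab : a < b)
    (hf : IntegrableOn f (Icc a b)) (hg : IntegrableOn g (Icc a b))
    (h : ∀ᵐ x ∂(volume.restrict (Icc a b)), f x ≤ g x) :
    ⨍ x in Icc a b, f x ≤ ⨍ x in Icc a b, g x := by
  rw [setAverage_Icc_eq hab, setAverage_Icc_eq hab]
  exact div_le_div_of_nonneg_right (integral_mono_ae hf hg h) (sub_pos.2 hab).le

lemma setAverage_Icc_const {a b : ℝ} (hab : a < b) (c : ℝ) : ⨍ _ in Icc a b, c = c := by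
  rw [setAverage_Icc_eq hab, setIntegral_const, Real.volume_real_Icc_of_le hab.le, smul_eq_mul,
    mul_div_cancel_left₀ _ (sub_pos.2 hab).ne']

/-! ### The function `|x|^{-1/2}` -/

/-- The function `|x|^{-1/2}`, as a sum of two terms exactly one of which is nonzero at `x ≠ 0`. -/
def invSqrtAbs (x : ℝ) : ℝ := x ^ (-(1 / 2) : ℝ) + (-x) ^ (-(1 / 2) : ℝ)

lemma rpow_neg_half_of_neg {x : ℝ} (hx : x < 0) : x ^ (-(1 / 2) : ℝ) = 0 := by
  rw [Real.rpow_def_of_neg hx, neg_mul, Real.cos_neg, one_div_mul_eq_div, Real.cos_pi_div_two,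
    mul_zero]

lemma invSqrtAbs_eq {x : ℝ} (hx : x ≠ 0) : invSqrtAbs x = Real.exp (-Real.log x / 2) := by
  unfold invSqrtAbs
  rcases hx.lt_or_gt with h | h
  · rw [rpow_neg_half_of_neg h, Real.rpow_def_of_pos (neg_pos.2 h), Real.log_neg_eq_log, zero_add]
    ring_nf
  · rw [rpow_neg_half_of_neg (neg_lt_zero.2 h), Real.rpow_def_of_pos h, add_zero]
    ring_nf

lemma sqrt_mul_invSqrtAbs {r x : ℝ} (hr : 0 < r) (hx : x ≠ 0) :
    √r * invSqrtAbs x = Real.exp ((Real.log r - Real.log x) / 2) := by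
  rw [invSqrtAbs_eq hx, ← Real.exp_log (Real.sqrt_pos.2 hr), Real.log_sqrt hr.le, ← Real.exp_add]
  ring_nf

lemma intervalIntegrable_invSqrtAbs (a b : ℝ) : IntervalIntegrable invSqrtAbs volume a b := by
  have h (a b : ℝ) := intervalIntegral.intervalIntegrable_rpow' (a := a) (b := b)
    (show (-1 : ℝ) < -(1 / 2) by norm_num)
  have h2 := (h (-a) (-b)).comp_sub_left 0
  simp only [zero_sub, neg_neg] at h2
  exact (h a b).add h2

lemma integrableOn_invSqrtAbs (a b : ℝ) : IntegrableOn invSqrtAbs (Icc a b) := by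
  rcases le_or_gt a b with h | h
  · exact (intervalIntegrable_iff_integrableOn_Icc_of_le h).1 (intervalIntegrable_invSqrtAbs a b)
  · simp [Icc_eq_empty_of_lt h]

lemma integral_invSqrtAbs {a b : ℝ} (hab : a ≤ b) :
    ∫ x in Icc a b, invSqrtAbs x = 2 * (√b - √a + √(-a) - √(-b)) := by
  have h (a b : ℝ) := intervalIntegral.intervalIntegrable_rpow' (a := a) (b := b)
    (show (-1 : ℝ) < -(1 / 2) by norm_num)
  have h2 := (h (-a) (-b)).comp_sub_left 0
  simp only [zero_sub, neg_neg] at h2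
  have h3 (a b : ℝ) : ∫ x in a..b, x ^ (-(1 / 2) : ℝ) = 2 * (√b - √a) := by
    rw [integral_rpow (Or.inl (by norm_num)), Real.sqrt_eq_rpow, Real.sqrt_eq_rpow]
    norm_num
    ring
  rw [integral_Icc_eq_integral_Ioc, ← intervalIntegral.integral_of_le hab]
  unfold invSqrtAbs
  rw [intervalIntegral.integral_add (h a b) h2, h3,
    intervalIntegral.integral_comp_neg (fun x => x ^ (-(1 / 2) : ℝ)), h3]
  ring

/-- On one side of the origin the mean is at most 2. If `a < 0 < b`, the integral of `|x|^{-1/2}` is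
`2(√b + √(-a)) ≤ 4√r` with `r = max (-a) b ≤ b - a`, which gives 4. -/
lemma setAverage_sqrt_mul_invSqrtAbs_le {a b : ℝ} (hab : a < b) :
    ⨍ x in Icc a b, √(max |a| |b|) * invSqrtAbs x ≤ 4 := by
  rw [setAverage_Icc_eq hab, integral_const_mul, integral_invSqrtAbs hab.le,
    div_le_iff₀ (sub_pos.2 hab)]
  rcases le_or_gt 0 a with ha | ha
  · have hb : 0 < b := ha.trans_lt hab
    have h1 : max |a| |b| = b := by
      rw [abs_of_nonneg ha, abs_of_pos hb, max_eq_right hab.le]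
    rw [h1, Real.sqrt_eq_zero_of_nonpos (neg_nonpos.2 ha),
      Real.sqrt_eq_zero_of_nonpos (neg_nonpos.2 hb.le)]
    nlinarith [Real.sq_sqrt ha, Real.sq_sqrt hb.le, Real.sqrt_le_sqrt hab.le, Real.sqrt_nonneg a]
  · rcases le_or_gt b 0 with hb | hb
    · have h1 : max |a| |b| = -a := by
        rw [abs_of_neg ha, abs_of_nonpos hb, max_eq_left (neg_le_neg hab.le)]
      rw [h1, Real.sqrt_eq_zero_of_nonpos ha.le, Real.sqrt_eq_zero_of_nonpos hb]
      nlinarith [Real.sq_sqrt (neg_pos.2 ha).le, Real.sq_sqrt (neg_nonneg.2 hb),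
        Real.sqrt_le_sqrt (neg_le_neg hab.le), Real.sqrt_nonneg (-b)]
    · rw [Real.sqrt_eq_zero_of_nonpos ha.le, Real.sqrt_eq_zero_of_nonpos (neg_lt_zero.2 hb).le,
        abs_of_neg ha, abs_of_pos hb]
      have h1 := Real.sq_sqrt (hb.le.trans (le_max_right (-a) b))
      have h2 := Real.sqrt_le_sqrt (le_max_left (-a) b)
      have h3 := Real.sqrt_le_sqrt (le_max_right (-a) b)
      have h4 : max (-a) b ≤ b - a := max_le (by linarith) (by linarith)
      nlinarith [Real.sqrt_nonneg (max (-a) b)]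

lemma ae_ne_zero_restrict (s : Set ℝ) : ∀ᵐ x ∂(volume.restrict s), x ≠ (0 : ℝ) :=
  ae_restrict_of_ae (Measure.ae_ne volume 0)

lemma integrableOn_Icc_of_le_invSqrtAbs {f : ℝ → ℝ} (hf : Measurable f) {a b A B : ℝ}
    (h : ∀ x ∈ Icc a b, x ≠ 0 → |f x| ≤ A + B * invSqrtAbs x) : IntegrableOn f (Icc a b) := by
  have h1 : IntegrableOn (fun x => A + B * invSqrtAbs x) (Icc a b) :=
    (integrableOn_const (by simp)).add ((integrableOn_invSqrtAbs a b).const_mul B)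
  refine Integrable.mono' h1 hf.aestronglyMeasurable ?_
  filter_upwards [ae_ne_zero_restrict (Icc a b), ae_restrict_mem measurableSet_Icc] with x h0 hx
  exact h x hx h0

lemma setAverage_le_of_le_invSqrtAbs {f : ℝ → ℝ} {a b A B : ℝ} (hab : a < b) (hB : 0 ≤ B)
    (hf : IntegrableOn f (Icc a b))
    (h : ∀ x ∈ Icc a b, x ≠ 0 → f x ≤ A + B * (√(max |a| |b|) * invSqrtAbs x)) :
    ⨍ x in Icc a b, f x ≤ A + 4 * B := by
  have h1 : IntegrableOn (fun x => B * (√(max |a| |b|) * invSqrtAbs x)) (Icc a b) :=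
    ((integrableOn_invSqrtAbs a b).const_mul _).const_mul B
  have h2 : IntegrableOn (fun _ => A) (Icc a b) := integrableOn_const (by simp)
  have h3 := setAverage_Icc_mono hab hf (h2.add h1) (by
    filter_upwards [ae_ne_zero_restrict (Icc a b), ae_restrict_mem measurableSet_Icc] with x h0 hx
    exact h x hx h0)
  refine h3.trans ?_
  have h4 := setAverage_sqrt_mul_invSqrtAbs_le hab
  have h5 := setAverage_Icc_const hab A
  rw [setAverage_Icc_eq hab] at h4 h5 ⊢
  simp only [Pi.add_apply]
  rw [integral_add h2 h1, add_div, h5, integral_const_mul, mul_div_assoc]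
  nlinarith

lemma locallyIntegrable_of_integrableOn_Icc {f : ℝ → ℝ}
    (hf : ∀ r : ℝ, 0 < r → IntegrableOn f (Icc (-r) r)) : LocallyIntegrable f := fun x =>
  ⟨Icc (-(|x| + 1)) (|x| + 1), Icc_mem_nhds (by linarith [neg_abs_le x]) (by linarith [le_abs_self x]),
    hf _ (by positivity)⟩

/-! ### Monotonicity in the interval -/

lemma lowerOsc_congr {f g : ℝ → ℝ} {a b : ℝ} (h : EqOn f g (Icc a b)) :
    lowerOsc f a b = lowerOsc g a b := by
  have h1 : f =ᵐ[volume.restrict (Icc a b)] g :=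
    (ae_restrict_mem measurableSet_Icc).mono fun x hx => h hx
  unfold lowerOsc
  have h2 : (fun x => (f x : EReal)) =ᵐ[volume.restrict (Icc a b)] fun x => (g x : EReal) :=
    h1.fun_comp (fun y : ℝ => (y : EReal))
  rw [average_congr h1, essInf_congr_ae h2]

lemma bloNorm_le_iff {J : Set ℝ} {f : ℝ → ℝ} {C : ℝ≥0∞} :
    bloNorm J f ≤ C ↔ ∀ a b, a < b → Icc a b ⊆ J → lowerOsc f a b ≤ C := by
  simp only [bloNorm, iSup_le_iff]

lemma lowerOsc_le_bloNorm {J : Set ℝ} (f : ℝ → ℝ) {a b : ℝ} (hab : a < b) (h : Icc a b ⊆ J) :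
    lowerOsc f a b ≤ bloNorm J f :=
  bloNorm_le_iff.1 le_rfl a b hab h

lemma bloNorm_mono {J K : Set ℝ} (hJK : J ⊆ K) {f g : ℝ → ℝ} (h : EqOn f g J) :
    bloNorm J f ≤ bloNorm K g :=
  bloNorm_le_iff.2 fun _ _ hab hJ => (lowerOsc_congr (h.mono hJ)).trans_le
    (lowerOsc_le_bloNorm g hab (hJ.trans hJK))

lemma locallyIntegrableOn_of_eqOn {J K : Set ℝ} (hJK : J ⊆ K) (hJ : MeasurableSet J)
    {f g : ℝ → ℝ} (h : EqOn f g J) (hg : LocallyIntegrableOn g K) : LocallyIntegrableOn f J := by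
  intro x hx
  obtain ⟨s, hs, hi⟩ := (hg.mono_set hJK) x hx
  refine ⟨s ∩ J, inter_mem hs self_mem_nhdsWithin, ?_⟩
  refine (hi.mono_set inter_subset_left).congr_fun_ae ?_
  refine ae_restrict_of_ae_restrict_of_subset inter_subset_right ?_
  exact (ae_restrict_mem hJ).mono fun y hy => (h hy).symm

lemma BLO_of_eqOn {J K : Set ℝ} (hJK : J ⊆ K) (hJ : MeasurableSet J) {f g : ℝ → ℝ}
    (h : EqOn f g J) (hg : g ∈ BLO K) : f ∈ BLO J :=
  ⟨locallyIntegrableOn_of_eqOn hJK hJ h hg.1, (bloNorm_mono hJK h).trans_lt hg.2⟩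

lemma Linfty_of_eqOn {J K : Set ℝ} (hJK : J ⊆ K) (hJ : MeasurableSet J) {f g : ℝ → ℝ}
    (h : EqOn f g J) (hg : g ∈ Linfty K) : f ∈ Linfty J := by
  have h1 : MemLp g ∞ (volume.restrict J) := MemLp.mono_measure (Measure.restrict_mono hJK le_rfl) hg
  exact (memLp_congr_ae ((ae_restrict_mem hJ).mono fun y hy => h hy)).2 h1

lemma TruncApprox_of_eqOn {J K : Set ℝ} (hJK : J ⊆ K) (hJ : MeasurableSet J) {f g : ℝ → ℝ}
    (h : EqOn f g J) (hg : g ∈ TruncApprox K) : f ∈ TruncApprox J := by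
  refine ⟨BLO_of_eqOn hJK hJ h hg.1, tendsto_of_tendsto_of_tendsto_of_le_of_le
    tendsto_const_nhds hg.2 (fun _ => zero_le) fun k => bloNorm_mono hJK fun x hx => ?_⟩
  simp only [Pi.sub_apply, trunc, h hx]

lemma closureLinfty_of_eqOn {J K : Set ℝ} (hJK : J ⊆ K) (hJ : MeasurableSet J) {f g : ℝ → ℝ}
    (h : EqOn f g J) (hg : g ∈ closureLinfty K) : f ∈ closureLinfty J := by
  refine ⟨BLO_of_eqOn hJK hJ h hg.1, le_antisymm ?_ zero_le⟩
  rw [← hg.2]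
  refine le_iInf₂ fun u hu => iInf₂_le_of_le u (Linfty_of_eqOn hJK hJ (eqOn_refl u J) hu) ?_
  exact bloNorm_mono hJK fun x hx => by simp only [Pi.sub_apply, h hx]

lemma MuckenhouptA1_of_eqOn {J K : Set ℝ} (hJK : J ⊆ K) (hJ : MeasurableSet J) {f g : ℝ → ℝ}
    (h : EqOn f g J) (hg : g ∈ MuckenhouptA1 K) : f ∈ MuckenhouptA1 J := by
  refine ⟨locallyIntegrableOn_of_eqOn hJK hJ h hg.1, ?_, lt_of_le_of_lt ?_ hg.2.2⟩
  · filter_upwards [ae_restrict_of_ae_restrict_of_subset hJK hg.2.1, ae_restrict_mem hJ] with x h1 h2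
    rwa [h h2]
  · refine iSup₂_le fun a b => iSup₂_le fun hab hs => ?_
    refine le_iSup₂_of_le a b (le_iSup₂_of_le hab (hs.trans hJK) (le_of_eq ?_))
    have h1 : f =ᵐ[volume.restrict (Icc a b)] g :=
      (ae_restrict_mem measurableSet_Icc).mono fun x hx => h (hs hx)
    have h2 : (fun x => ENNReal.ofReal (f x)) =ᵐ[volume.restrict (Icc a b)]
        fun x => ENNReal.ofReal (g x) := h1.fun_comp ENNReal.ofReal
    rw [average_congr h1, essInf_congr_ae h2]

/-! ### The inclusions -/

lemma aestronglyMeasurable_trunc {k : ℕ} {f : ℝ → ℝ} {μ : Measure ℝ} (hf : AEStronglyMeasurable f μ) :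
    AEStronglyMeasurable (trunc k f) μ :=
  (show Continuous fun y : ℝ => max (-(k : ℝ)) (min (k : ℝ) y) by
    fun_prop).comp_aestronglyMeasurable hf

lemma abs_trunc_le (k : ℕ) (f : ℝ → ℝ) (x : ℝ) : |trunc k f x| ≤ k :=
  abs_le.2 ⟨le_max_left _ _, max_le (by linarith [k.cast_nonneg (α := ℝ)]) (min_le_left _ _)⟩

lemma trunc_mem_Linfty {J : Set ℝ} {f : ℝ → ℝ}
    (hf : AEStronglyMeasurable f (volume.restrict J)) (k : ℕ) : trunc k f ∈ Linfty J :=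
  memLp_top_of_bound (aestronglyMeasurable_trunc hf) k (ae_of_all _ fun x => abs_trunc_le k f x)

lemma exists_ae_abs_le {J : Set ℝ} {f : ℝ → ℝ} (hf : f ∈ Linfty J) :
    ∃ C : ℝ, ∀ᵐ x ∂(volume.restrict J), |f x| ≤ C :=
  ⟨(eLpNorm f ∞ (volume.restrict J)).toReal, by
    filter_upwards [ae_le_eLpNormEssSup (f := f) (μ := volume.restrict J)] with x hx
    rw [← Real.norm_eq_abs, ← toReal_enorm]
    exact ENNReal.toReal_mono hf.2.ne (by rwa [eLpNorm_exponent_top])⟩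

lemma Linfty_subset_TruncApprox (J : Set ℝ) : Linfty J ⊆ TruncApprox J := by
  intro f hf
  have hf' : MemLp f ∞ (volume.restrict J) := hf
  obtain ⟨C, hC⟩ := exists_ae_abs_le hf
  have hi : LocallyIntegrableOn f J :=
    locallyIntegrableOn_of_locallyIntegrable_restrict (hf'.locallyIntegrable (by simp))
  refine ⟨⟨hi, lt_of_le_of_lt ?_ (ENNReal.ofReal_lt_top (r := C - -C))⟩, ?_⟩
  · refine bloNorm_le_iff.2 fun a b hab hs => ?_
    have h1 := ae_restrict_of_ae_restrict_of_subset hs hC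
    have h2 := hi.integrableOn_compact_subset hs isCompact_Icc
    refine lowerOsc_le (h1.mono fun x hx => (abs_le.1 hx).1) ?_
    rw [← setAverage_Icc_const hab C]
    exact setAverage_Icc_mono hab h2 (integrableOn_const (by simp))
      (h1.mono fun x hx => (abs_le.1 hx).2)
  · refine tendsto_const_nhds.congr' ?_
    -- Beyond an essential bound of `f`, truncation changes nothing almost everywhere.
    obtain ⟨N, hN⟩ := exists_nat_ge C
    filter_upwards [eventually_ge_atTop N] with k hk
    refine (le_antisymm (bloNorm_le_iff.2 fun a b hab hs => ?_) zero_le).symm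
    have h1 : f - trunc k f =ᵐ[volume.restrict (Icc a b)] fun _ => 0 := by
      filter_upwards [ae_restrict_of_ae_restrict_of_subset hs hC] with x hx
      have h2 := abs_le.1 (hx.trans (hN.trans (Nat.cast_le.2 hk)))
      simp only [Pi.sub_apply, trunc]
      rw [min_eq_right h2.2, max_eq_right h2.1, sub_self]
    have := lowerOsc_le (m := 0) (M := 0) (h1.mono fun x hx => hx.ge)
      (by rw [average_congr h1, setAverage_Icc_const hab])
    simpa using this

lemma TruncApprox_subset_closureLinfty (J : Set ℝ) :
    TruncApprox J ⊆ closureLinfty J := by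
  intro f hf
  refine ⟨hf.1, le_antisymm (ge_of_tendsto' hf.2 fun k => ?_) zero_le⟩
  exact iInf₂_le (trunc k f) (trunc_mem_Linfty hf.1.1.aestronglyMeasurable k)

/-! ### The even extension of `log (-log x)` to the line -/

/-- The even extension by zero of `log (-log x)`, lowered by `log K` and cut off below at zero. -/
def logLogAbove (K x : ℝ) : ℝ := Real.log (max 1 (-Real.log x / K))

lemma logLogAbove_nonneg (K x : ℝ) : 0 ≤ logLogAbove K x := Real.log_nonneg (le_max_left _ _)

lemma measurable_logLogAbove (K : ℝ) : Measurable (logLogAbove K) :=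
  Real.measurable_log.comp (measurable_const.max (Real.measurable_log.neg.div_const K))

lemma log_le_log_of_abs_le {r x : ℝ} (hx : x ≠ 0) (hr : |x| ≤ r) : Real.log x ≤ Real.log r := by
  rw [← Real.log_abs x]
  exact Real.log_le_log (abs_pos.2 hx) hr

lemma logLogAbove_anti {K r x : ℝ} (hK : 0 < K) (hx : x ≠ 0) (hr : |x| ≤ r) :
    logLogAbove K r ≤ logLogAbove K x := by
  refine Real.log_le_log (by positivity) (max_le_max le_rfl ?_)
  exact div_le_div_of_nonneg_right (neg_le_neg (log_le_log_of_abs_le hx hr)) hK.le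

/-- This is `max(1, A + s) ≤ max(1, A)(1 + s)` for `s ≥ 0`, after taking logarithms. -/
lemma logLogAbove_le_add_log {K r x : ℝ} (hK : 0 < K) (hx : x ≠ 0) (hr : |x| ≤ r) :
    logLogAbove K x ≤ logLogAbove K r + Real.log (1 + (Real.log r - Real.log x) / K) := by
  have hs : 0 ≤ (Real.log r - Real.log x) / K :=
    div_nonneg (sub_nonneg.2 (log_le_log_of_abs_le hx hr)) hK.le
  unfold logLogAbove
  rw [← Real.log_mul (by positivity) (by positivity)]
  refine Real.log_le_log (by positivity) ?_
  have h1 := le_max_left 1 (-Real.log r / K)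
  have h2 := le_max_right 1 (-Real.log r / K)
  have h3 : -Real.log x / K = -Real.log r / K + (Real.log r - Real.log x) / K := by ring
  refine max_le (by nlinarith) ?_
  rw [h3]
  nlinarith

lemma logLogAbove_le_add_invSqrtAbs {K r x : ℝ} (hK : 0 < K) (hx : x ≠ 0) (hr : |x| ≤ r) :
    logLogAbove K x ≤ logLogAbove K r + 2 / K * (√r * invSqrtAbs x) := by
  have hs : 0 ≤ Real.log r - Real.log x := sub_nonneg.2 (log_le_log_of_abs_le hx hr)
  rw [sqrt_mul_invSqrtAbs ((abs_pos.2 hx).trans_le hr) hx]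
  have h1 := Real.log_le_sub_one_of_pos (x := 1 + (Real.log r - Real.log x) / K) (by positivity)
  have h2 := Real.add_one_le_exp ((Real.log r - Real.log x) / 2)
  have h3 : (Real.log r - Real.log x) / K ≤
      2 / K * Real.exp ((Real.log r - Real.log x) / 2) := by
    rw [div_mul_eq_mul_div]
    exact div_le_div_of_nonneg_right (by linarith) hK.le
  linarith [logLogAbove_le_add_log hK hx hr]

/-- The constant `(-log δ + δ - 1) / μ` with `δ = μ / 2`: `log (1 + s) / μ ≤ powLogConst μ + s / 2`. -/
def powLogConst (μ : ℝ) : ℝ := (-Real.log (μ / 2) + μ / 2 - 1) / μ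

lemma exp_logLogAbove_div_le {μ r x : ℝ} (hμ : 0 < μ) (hx : x ≠ 0) (hr : |x| ≤ r) :
    Real.exp (logLogAbove 1 x / μ) ≤
      Real.exp (logLogAbove 1 r / μ) * (Real.exp (powLogConst μ) * (√r * invSqrtAbs x)) := by
  have hs : 0 ≤ Real.log r - Real.log x := sub_nonneg.2 (log_le_log_of_abs_le hx hr)
  rw [sqrt_mul_invSqrtAbs ((abs_pos.2 hx).trans_le hr) hx, ← Real.exp_add, ← Real.exp_add,
    Real.exp_le_exp]
  have h1 := logLogAbove_le_add_log one_pos hx hr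
  rw [div_one] at h1
  set s := Real.log r - Real.log x
  -- The tangent bound with slope `μ/2` leaves `s/2` after division by `μ`: the integrable power
  -- `|x|^{-1/2}`, whatever `μ` is.
  have h2 := Real.log_le_sub_one_of_pos (x := μ / 2 * (1 + s)) (by positivity)
  rw [Real.log_mul (by positivity) (by positivity)] at h2
  have h3 : logLogAbove 1 x / μ ≤
      (logLogAbove 1 r + ((-Real.log (μ / 2) + μ / 2 - 1) + μ * (s / 2))) / μ :=
    div_le_div_of_nonneg_right (by linarith) hμ.le
  refine h3.trans (le_of_eq ?_)
  unfold powLogConst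
  field_simp

/-- As `F ≥ 0`, the lower truncation is inactive and the difference is `max(k, F) - k`; subtracting
`k` divides by `e^k` inside the logarithm. -/
lemma sub_trunc_logLogAbove (k : ℕ) :
    logLogAbove 1 - trunc k (logLogAbove 1) = logLogAbove (Real.exp k) := by
  ext x
  have h0 := logLogAbove_nonneg 1 x
  have hk : (1 : ℝ) ≤ Real.exp k := Real.one_le_exp k.cast_nonneg
  have h1 : logLogAbove (Real.exp k) x = max (k : ℝ) (logLogAbove 1 x) - k := by
    have h2 : max 1 (-Real.log x / Real.exp k)
        = max (Real.exp k) (max 1 (-Real.log x / 1)) / Real.exp k := by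
      rw [← max_assoc, max_eq_left hk, ← max_div_div_right (Real.exp_pos _).le, div_one,
        div_self (Real.exp_pos _).ne']
    have h3 : max (Real.exp k) (max 1 (-Real.log x / 1))
        = Real.exp (max (k : ℝ) (logLogAbove 1 x)) := by
      rw [Real.exp_monotone.map_max, logLogAbove, Real.exp_log (by positivity)]
    rw [logLogAbove, h2, h3, ← Real.exp_sub, Real.log_exp]
  rw [h1]
  simp only [Pi.sub_apply, trunc]
  rw [max_eq_right (le_min (by linarith [k.cast_nonneg (α := ℝ)])
    (by linarith [k.cast_nonneg (α := ℝ)]))]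
  linarith [min_add_max (k : ℝ) (logLogAbove 1 x)]

lemma logLogAbove_one_of_mem {x : ℝ} (hx : x ∈ baseInterval) : logLog x = logLogAbove 1 x := by
  have h1 : Real.log x < -1 := by
    rw [Real.log_lt_iff_lt_exp hx.1, Real.exp_neg, ← one_div]
    exact hx.2
  unfold logLog logLogAbove
  rw [div_one, max_eq_right (by linarith)]

/-! ### Functions within bounded distance below the extension -/

lemma abs_le_max_abs_of_mem_Icc {a b x : ℝ} (hx : x ∈ Icc a b) : |x| ≤ max |a| |b| :=
  abs_le_max_abs_abs hx.1 hx.2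

lemma locallyIntegrable_of_near_logLogAbove {g : ℝ → ℝ} (hg : Measurable g) {K : ℝ} (hK : 0 < K)
    (h1 : ∀ x, logLogAbove K x - 1 ≤ g x) (h2 : ∀ x, g x ≤ logLogAbove K x) :
    LocallyIntegrable g := by
  refine locallyIntegrable_of_integrableOn_Icc fun r hr =>
    integrableOn_Icc_of_le_invSqrtAbs hg (A := 1 + logLogAbove K r) (B := 2 / K * √r)
      fun x hx h0 => ?_
  have h3 := logLogAbove_le_add_invSqrtAbs hK h0 (abs_le.2 hx)
  rw [← mul_assoc] at h3
  have h4 := logLogAbove_nonneg K x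
  exact abs_le.2 ⟨by linarith [h1 x], by linarith [h2 x]⟩

/-- The value at `max |a| |b|` bounds the mean from above and, up to `c`, the infimum from below.
Smallness needs `c = 0` and large `K`; `c = 1` serves for finiteness. -/
lemma bloNorm_le_of_near_logLogAbove {g : ℝ → ℝ} {K c : ℝ} (hK : 0 < K)
    (hi : LocallyIntegrable g)
    (h1 : ∀ x, logLogAbove K x - c ≤ g x) (h2 : ∀ x, g x ≤ logLogAbove K x) :
    bloNorm univ g ≤ ENNReal.ofReal (c + 8 / K) := by
  refine bloNorm_le_iff.2 fun a b hab _ => ?_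
  have h3 := setAverage_le_of_le_invSqrtAbs (A := logLogAbove K (max |a| |b|)) (B := 2 / K) hab
    (by positivity) (hi.integrableOn_isCompact isCompact_Icc) fun x hx h0 =>
      (h2 x).trans (logLogAbove_le_add_invSqrtAbs hK h0 (abs_le_max_abs_of_mem_Icc hx))
  have h4 : ∀ᵐ x ∂(volume.restrict (Icc a b)), logLogAbove K (max |a| |b|) - c ≤ g x := by
    filter_upwards [ae_ne_zero_restrict (Icc a b), ae_restrict_mem measurableSet_Icc] with x h0 hx
    linarith [h1 x, logLogAbove_anti hK h0 (abs_le_max_abs_of_mem_Icc hx)]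
  refine (lowerOsc_le h4 h3).trans (ENNReal.ofReal_le_ofReal (le_of_eq ?_))
  ring

lemma mem_BLO_of_near_logLogAbove {g : ℝ → ℝ} (hg : Measurable g)
    (h1 : ∀ x, logLogAbove 1 x - 1 ≤ g x) (h2 : ∀ x, g x ≤ logLogAbove 1 x) : g ∈ BLO univ := by
  have hi := locallyIntegrable_of_near_logLogAbove hg one_pos h1 h2
  exact ⟨hi.locallyIntegrableOn _,
    (bloNorm_le_of_near_logLogAbove one_pos hi h1 h2).trans_lt ENNReal.ofReal_lt_top⟩

/-- The gap of 1 between the two bounds on `g` costs only a factor `e^{1/μ}` in the `A_1` constant.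
-/
lemma exp_div_mem_MuckenhouptA1 {g : ℝ → ℝ} (hg : Measurable g)
    (h1 : ∀ x, logLogAbove 1 x - 1 ≤ g x) (h2 : ∀ x, g x ≤ logLogAbove 1 x) {μ : ℝ} (hμ : 0 < μ) :
    (fun x => Real.exp (g x / μ)) ∈ MuckenhouptA1 univ := by
  have hle (r x : ℝ) (h0 : x ≠ 0) (hr : |x| ≤ r) : Real.exp (g x / μ) ≤
      0 + (Real.exp (logLogAbove 1 r / μ) * Real.exp (powLogConst μ)) * (√r * invSqrtAbs x) := by
    rw [zero_add, mul_assoc]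
    exact (Real.exp_le_exp.2 (div_le_div_of_nonneg_right (h2 x) hμ.le)).trans
      (exp_logLogAbove_div_le hμ h0 hr)
  have hi : LocallyIntegrable fun x => Real.exp (g x / μ) := by
    refine locallyIntegrable_of_integrableOn_Icc fun r hr =>
      integrableOn_Icc_of_le_invSqrtAbs (Real.measurable_exp.comp (hg.div_const μ)) (A := 0)
        (B := (Real.exp (logLogAbove 1 r / μ) * Real.exp (powLogConst μ)) * √r) fun x hx h0 => ?_
    rw [Function.comp_apply, abs_of_pos (Real.exp_pos _), mul_assoc _ √r]
    exact hle r x h0 (abs_le.2 hx)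
  refine ⟨hi.locallyIntegrableOn _, ae_of_all _ fun x => Real.exp_pos _,
    lt_of_le_of_lt (b := ENNReal.ofReal (4 * Real.exp (powLogConst μ) * Real.exp (1 / μ))) ?_
      ENNReal.ofReal_lt_top⟩
  refine iSup₂_le fun a b => iSup₂_le fun hab _ => ?_
  have h3 := setAverage_le_of_le_invSqrtAbs hab (by positivity)
    (hi.integrableOn_isCompact isCompact_Icc)
    fun x hx h0 => hle (max |a| |b|) x h0 (abs_le_max_abs_of_mem_Icc hx)
  set m := Real.exp ((logLogAbove 1 (max |a| |b|) - 1) / μ) with hm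
  have h4 : ENNReal.ofReal m ≤
      essInf (fun x => ENNReal.ofReal (Real.exp (g x / μ))) (volume.restrict (Icc a b)) := by
    refine le_essInf_of_ae_le _ ?_
    filter_upwards [ae_ne_zero_restrict (Icc a b), ae_restrict_mem measurableSet_Icc] with x h0 hx
    refine ENNReal.ofReal_le_ofReal (Real.exp_le_exp.2 (div_le_div_of_nonneg_right ?_ hμ.le))
    linarith [h1 x, logLogAbove_anti one_pos h0 (abs_le_max_abs_of_mem_Icc hx)]
  refine ENNReal.div_le_of_le_mul ((ENNReal.ofReal_le_ofReal h3).trans ?_)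
  refine le_trans (le_of_eq ?_) (mul_le_mul_right h4 _)
  rw [← ENNReal.ofReal_mul (by positivity)]
  congr 1
  have h5 : Real.exp (logLogAbove 1 (max |a| |b|) / μ) = Real.exp (1 / μ) * m := by
    rw [hm, ← Real.exp_add]
    congr 1
    ring
  rw [h5]
  ring

lemma logLogAbove_mem_TruncApprox : logLogAbove 1 ∈ TruncApprox univ := by
  refine ⟨mem_BLO_of_near_logLogAbove (measurable_logLogAbove 1) (fun x => by linarith)
    fun x => le_rfl, ?_⟩
  have h1 : Tendsto (fun k : ℕ => ENNReal.ofReal (0 + 8 / Real.exp k)) atTop (𝓝 0) := by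
    have h2 : Tendsto (fun k : ℕ => 0 + 8 / Real.exp (k : ℝ)) atTop (𝓝 (0 + 0)) :=
      ((Real.tendsto_exp_atTop.comp tendsto_natCast_atTop_atTop).const_div_atTop 8).const_add 0
    simpa using ENNReal.tendsto_ofReal h2
  refine tendsto_of_tendsto_of_tendsto_of_le_of_le tendsto_const_nhds h1 (fun _ => zero_le)
    fun k => ?_
  simp only [sub_trunc_logLogAbove]
  exact bloNorm_le_of_near_logLogAbove (Real.exp_pos _)
    (locallyIntegrable_of_near_logLogAbove (measurable_logLogAbove _) (Real.exp_pos _)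
      (fun x => by linarith) fun x => le_rfl) (fun x => by linarith) fun x => le_rfl

lemma mem_closureLinfty_of_near_logLogAbove {g : ℝ → ℝ} (hg : Measurable g)
    (h1 : ∀ x, logLogAbove 1 x - 1 ≤ g x) (h2 : ∀ x, g x ≤ logLogAbove 1 x) :
    g ∈ closureLinfty univ := by
  refine ⟨mem_BLO_of_near_logLogAbove hg h1 h2, le_antisymm
    (ge_of_tendsto' logLogAbove_mem_TruncApprox.2 fun k => ?_) zero_le⟩
  have hF := measurable_logLogAbove 1
  have h3 : (g - logLogAbove 1) + trunc k (logLogAbove 1) ∈ Linfty univ := by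
    refine MemLp.add (memLp_top_of_bound (hg.sub hF).aestronglyMeasurable 1
      (ae_of_all _ fun x => ?_)) (trunc_mem_Linfty hF.aestronglyMeasurable k)
    rw [Pi.sub_apply, Real.norm_eq_abs]
    exact abs_le.2 ⟨by linarith [h1 x], by linarith [h2 x]⟩
  refine (iInf₂_le _ h3).trans (le_of_eq ?_)
  congr 1
  abel

/-! ### The integer-valued minorant -/

/-- The even extension by zero of the step function to the line. -/
def ceilLogLog (x : ℝ) : ℝ := ((⌈logLogAbove 1 x⌉₊ - 1 : ℕ) : ℝ)

lemma measurable_ceilLogLog : Measurable ceilLogLog :=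
  (measurable_from_top (f := fun n : ℕ => ((n - 1 : ℕ) : ℝ))).comp
    (Nat.measurable_ceil.comp (measurable_logLogAbove 1))

lemma sub_one_le_ceilLogLog (x : ℝ) : logLogAbove 1 x - 1 ≤ ceilLogLog x := by
  have h1 := Nat.le_ceil (logLogAbove 1 x)
  have h2 : (⌈logLogAbove 1 x⌉₊ : ℝ) ≤ ((⌈logLogAbove 1 x⌉₊ - 1 + 1 : ℕ) : ℝ) :=
    Nat.cast_le.2 le_tsub_add
  unfold ceilLogLog
  push_cast at h2
  linarith

lemma ceilLogLog_le (x : ℝ) : ceilLogLog x ≤ logLogAbove 1 x := by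
  have h0 := logLogAbove_nonneg 1 x
  unfold ceilLogLog
  rcases Nat.eq_zero_or_pos ⌈logLogAbove 1 x⌉₊ with h | h
  · rw [h]
    simpa using h0
  · rw [Nat.cast_pred h]
    linarith [Nat.ceil_lt_add_one h0]

lemma natCast_lt_logLogAbove_iff (n : ℕ) {x : ℝ} (hx : 0 < x) :
    (n : ℝ) < logLogAbove 1 x ↔ x < stepPoint n := by
  have hn : (1 : ℝ) ≤ Real.exp n := Real.one_le_exp n.cast_nonneg
  unfold logLogAbove stepPoint
  rw [Real.lt_log_iff_exp_lt (by positivity), lt_max_iff, div_one, ← Real.log_lt_iff_lt_exp hx,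
    lt_neg]
  exact or_iff_right hn.not_gt

/-- `F` is nonincreasing on `x > 0`, so intervals closed on the left in `x` become closed on the
right in `F`; hence a ceiling minus one, not a floor. -/
lemma mem_Ico_stepPoint_iff (n : ℕ) {x : ℝ} (hx : 0 < x) :
    x ∈ Ico (stepPoint (n + 1)) (stepPoint n) ↔
      (n : ℝ) < logLogAbove 1 x ∧ logLogAbove 1 x ≤ ((n + 1 : ℕ) : ℝ) := by
  rw [mem_Ico, ← natCast_lt_logLogAbove_iff n hx, ← not_lt, ← natCast_lt_logLogAbove_iff _ hx,
    not_lt, and_comm]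

lemma stepFun_eq_ceilLogLog {x : ℝ} (hx : 0 < x) : stepFun x = ceilLogLog x := by
  unfold stepFun ceilLogLog
  rw [tsum_eq_single (⌈logLogAbove 1 x⌉₊ - 1)]
  · rcases Nat.eq_zero_or_pos ⌈logLogAbove 1 x⌉₊ with h | h
    -- Here `F = 0`: natural subtraction selects `n = 0`, whose coefficient vanishes.
    · simp [h]
    · rw [indicator_of_mem, mul_one]
      rw [mem_Ico_stepPoint_iff _ hx, Nat.sub_add_cancel h]
      exact ⟨Nat.lt_ceil.1 (Nat.sub_lt h one_pos), Nat.le_ceil _⟩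
  · intro n hn
    rw [indicator_of_notMem, mul_zero]
    rw [mem_Ico_stepPoint_iff _ hx]
    rintro ⟨h1, h2⟩
    have h3 := Nat.lt_ceil.2 h1
    have h4 := Nat.ceil_le.2 h2
    omega

/-! ### Failure of truncation for the step function, and unboundedness of `log (-log x)` -/

lemma stepPoint_pos (n : ℕ) : 0 < stepPoint n := Real.exp_pos _

lemma stepPoint_succ_lt (n : ℕ) : stepPoint (n + 1) < 1 / Real.exp 1 := by
  unfold stepPoint
  rw [one_div, ← Real.exp_neg, Real.exp_lt_exp, neg_lt_neg_iff]
  exact Real.one_lt_exp_iff.2 (by positivity)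

lemma half_le_bloNorm_stepFun_sub_trunc (k : ℕ) :
    ENNReal.ofReal (1 / 2) ≤ bloNorm baseInterval (stepFun - trunc k stepFun) := by
  -- At `a_{k+1}` the step function drops from `k + 1` to `k`, the first jump that truncation at
  -- level `k` does not preserve.
  set s := stepPoint (k + 1) with hs
  have hs0 : 0 < s := stepPoint_pos _
  have hs1 : s < 1 / Real.exp 1 := stepPoint_succ_lt k
  obtain ⟨d, hd0, hd1, hd2⟩ : ∃ d, 0 < d ∧ d < s ∧ d < 1 / Real.exp 1 - s := by
    obtain ⟨d, h1, h2⟩ := exists_between (lt_min hs0 (sub_pos.2 hs1))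
    exact ⟨d, h1, lt_min_iff.1 h2⟩
  have hsub : Icc (s - d) (s + d) ⊆ baseInterval := fun x hx =>
    ⟨by linarith [hx.1], by linarith [hx.2]⟩
  have hab : s - d < s + d := by linarith
  set u := stepFun - trunc k stepFun with hu
  have hux (x : ℝ) (hx : 0 < x) : u x = max 0 (ceilLogLog x - k) := by
    have h0 : (0 : ℝ) ≤ ceilLogLog x := Nat.cast_nonneg _
    have hk : (0 : ℝ) ≤ k := k.cast_nonneg
    rw [hu, Pi.sub_apply, trunc, stepFun_eq_ceilLogLog hx]
    rw [max_eq_right (le_min (by linarith) (by linarith)), sub_eq_iff_eq_add]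
    rcases le_total (k : ℝ) (ceilLogLog x) with h | h
    · rw [min_eq_left h, max_eq_right (by linarith)]; ring
    · rw [min_eq_right h, max_eq_left (by linarith)]; ring
  have hi : IntegrableOn u (Icc (s - d) (s + d)) := by
    have h1 : LocallyIntegrable ceilLogLog := locallyIntegrable_of_near_logLogAbove
      measurable_ceilLogLog one_pos sub_one_le_ceilLogLog ceilLogLog_le
    have h2 := (h1.integrableOn_isCompact (isCompact_Icc (a := s - d) (b := s + d)))
    have h3 : IntegrableOn (fun x => ceilLogLog x - k) (Icc (s - d) (s + d)) :=
      h2.sub (integrableOn_const (by simp))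
    refine (h3.pos_part).congr ?_
    filter_upwards [ae_restrict_mem measurableSet_Icc] with x hx
    rw [hux x (hsub hx).1, max_comm]
  have hleft : ∀ x ∈ Ico (s - d) s, 1 ≤ u x := fun x hx => by
    have hx0 : 0 < x := by linarith [hx.1]
    rw [hux x hx0]
    refine le_max_of_le_right ?_
    have h1 := Nat.lt_ceil.2 ((natCast_lt_logLogAbove_iff (k + 1) hx0).2 hx.2)
    have h2 : ((k + 1 : ℕ) : ℝ) ≤ ceilLogLog x := Nat.cast_le.2 (by omega)
    push_cast at h2
    linarith
  have hright : ∀ x ∈ Icc s (s + d), u x ≤ 0 := fun x hx => by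
    have hx0 : 0 < x := hs0.trans_le hx.1
    rw [hux x hx0]
    refine max_le le_rfl ?_
    have h1 := Nat.ceil_le.2 (not_lt.1 (mt (natCast_lt_logLogAbove_iff (k + 1) hx0).1 hx.1.not_gt))
    have h2 : ceilLogLog x ≤ (k : ℝ) := Nat.cast_le.2 (by omega)
    linarith
  -- The left half of the interval contributes at least 1 and the right half is nonnegative.
  have hmean : 1 / 2 ≤ ⨍ x in Icc (s - d) (s + d), u x := by
    rw [setAverage_Icc_eq hab, le_div_iff₀ (sub_pos.2 hab)]
    have hss : Ico (s - d) s ⊆ Icc (s - d) (s + d) := fun x hx => ⟨hx.1, by linarith [hx.2]⟩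
    have h1 : ∫ _ in Ico (s - d) s, (1 : ℝ) ≤ ∫ x in Ico (s - d) s, u x :=
      setIntegral_mono_on (integrableOn_const (by simp)) (hi.mono_set hss) measurableSet_Ico hleft
    have h2 : ∫ x in Ico (s - d) s, u x ≤ ∫ x in Icc (s - d) (s + d), u x := by
      refine setIntegral_mono_set hi ?_ (LE.le.eventuallyLE hss)
      filter_upwards [ae_restrict_mem measurableSet_Icc] with x hx
      rw [hux x (hsub hx).1]
      exact le_max_left _ _
    rw [setIntegral_const, Real.volume_real_Ico_of_le (by linarith), smul_eq_mul] at h1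
    linarith
  have hfreq : ∃ᶠ x in ae (volume.restrict (Icc (s - d) (s + d))), u x ≤ 0 := by
    rw [frequently_ae_iff]
    refine ne_of_gt (lt_of_lt_of_le ?_ (measure_mono (s := Icc s (s + d)) hright))
    rw [Measure.restrict_apply measurableSet_Icc, inter_eq_self_of_subset_left
      (Icc_subset_Icc_left (by linarith)), Real.volume_Icc]
    exact ENNReal.ofReal_pos.2 (by linarith)
  have := le_lowerOsc hfreq hmean
  rw [sub_zero] at this
  exact this.trans (lowerOsc_le_bloNorm u hab hsub)

lemma stepFun_notMem_TruncApprox : stepFun ∉ TruncApprox baseInterval := fun h => by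
  have h1 := ge_of_tendsto' h.2 half_le_bloNorm_stepFun_sub_trunc
  rw [nonpos_iff_eq_zero, ENNReal.ofReal_eq_zero] at h1
  norm_num at h1

lemma logLog_notMem_Linfty : logLog ∉ Linfty baseInterval := fun h => by
  obtain ⟨C, hC⟩ := exists_ae_abs_le h
  obtain ⟨n, hn⟩ := exists_nat_ge C
  have hs0 := stepPoint_pos (n + 1)
  have hsub : Ioo 0 (stepPoint (n + 1)) ⊆ baseInterval :=
    Ioo_subset_Ioo_right (stepPoint_succ_lt n).le
  -- On `(0, a_{n+1})` the function exceeds `n + 1 > C`, so this interval would have to be null.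
  have h1 : ∀ᵐ x ∂(volume.restrict (Ioo 0 (stepPoint (n + 1)))), False := by
    filter_upwards [ae_restrict_of_ae_restrict_of_subset hsub hC, ae_restrict_mem measurableSet_Ioo]
      with x h2 hx
    have h3 := (natCast_lt_logLogAbove_iff (n + 1) hx.1).2 hx.2
    rw [← logLogAbove_one_of_mem (hsub hx)] at h3
    push_cast at h3
    linarith [le_abs_self (logLog x)]
  rw [eventually_false_iff_eq_bot, ae_eq_bot, Measure.restrict_eq_zero, Real.volume_Ioo,
    ENNReal.ofReal_eq_zero] at h1
  linarith

end LowerOscillation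
end

theorem mainTheorem3 :
    -- the strict inclusions on the whole line
    (LowerOscillation.Linfty Set.univ ⊂ LowerOscillation.TruncApprox Set.univ ∧
      LowerOscillation.TruncApprox Set.univ ⊂ LowerOscillation.closureLinfty Set.univ) ∧
    -- the strict inclusions on `(0, 1/e)`
    (LowerOscillation.Linfty LowerOscillation.baseInterval ⊂
        LowerOscillation.TruncApprox LowerOscillation.baseInterval ∧
      LowerOscillation.TruncApprox LowerOscillation.baseInterval ⊂
        LowerOscillation.closureLinfty LowerOscillation.baseInterval) ∧
    -- `log (-log x)` is unbounded and approximable by truncation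
    (LowerOscillation.logLog ∉ LowerOscillation.Linfty LowerOscillation.baseInterval ∧
      LowerOscillation.logLog ∈ LowerOscillation.TruncApprox LowerOscillation.baseInterval ∧
      ∀ μ : ℝ, 0 < μ → (fun x => Real.exp (LowerOscillation.logLog x / μ)) ∈
        LowerOscillation.MuckenhouptA1 LowerOscillation.baseInterval) ∧
    -- the step function is in the closure but not approximable by truncation
    (LowerOscillation.stepFun ∈ LowerOscillation.closureLinfty LowerOscillation.baseInterval ∧
      LowerOscillation.stepFun ∉ LowerOscillation.TruncApprox LowerOscillation.baseInterval ∧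
      ∀ μ : ℝ, 0 < μ → (fun x => Real.exp (LowerOscillation.stepFun x / μ)) ∈
        LowerOscillation.MuckenhouptA1 LowerOscillation.baseInterval) := by
  open LowerOscillation in
  have hJ : MeasurableSet baseInterval := measurableSet_Ioo
  have hlog : EqOn logLog (logLogAbove 1) baseInterval := fun x hx => logLogAbove_one_of_mem hx
  have hstep : EqOn stepFun ceilLogLog baseInterval := fun x hx => stepFun_eq_ceilLogLog hx.1
  have hJu := subset_univ baseInterval
  have hlogT := TruncApprox_of_eqOn hJu hJ hlog logLogAbove_mem_TruncApprox
  have hceil := mem_closureLinfty_of_near_logLogAbove measurable_ceilLogLog sub_one_le_ceilLogLog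
    ceilLogLog_le
  have hstepC := closureLinfty_of_eqOn hJu hJ hstep hceil
  refine ⟨⟨?_, ?_⟩, ⟨?_, ?_⟩, ⟨logLog_notMem_Linfty, hlogT, fun μ hμ => ?_⟩, hstepC,
    stepFun_notMem_TruncApprox, fun μ hμ => ?_⟩
  · exact (ssubset_iff_of_subset (Linfty_subset_TruncApprox _)).2 ⟨_, logLogAbove_mem_TruncApprox,
      fun h => logLog_notMem_Linfty (Linfty_of_eqOn hJu hJ hlog h)⟩
  · exact (ssubset_iff_of_subset (TruncApprox_subset_closureLinfty _)).2 ⟨_, hceil,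
      fun h => stepFun_notMem_TruncApprox (TruncApprox_of_eqOn hJu hJ hstep h)⟩
  · exact (ssubset_iff_of_subset (Linfty_subset_TruncApprox _)).2 ⟨_, hlogT, logLog_notMem_Linfty⟩
  · exact (ssubset_iff_of_subset (TruncApprox_subset_closureLinfty _)).2 ⟨_, hstepC,
      stepFun_notMem_TruncApprox⟩
  · exact MuckenhouptA1_of_eqOn hJu hJ (fun x hx => by simp only [hlog hx])
      (exp_div_mem_MuckenhouptA1 (measurable_logLogAbove 1) (fun x => by linarith)
        (fun x => le_rfl) hμ)
  · exact MuckenhouptA1_of_eqOn hJu hJ (fun x hx => by simp only [hstep hx])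
      (exp_div_mem_MuckenhouptA1 measurable_ceilLogLog sub_one_le_ceilLogLog ceilLogLog_le hμ)
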